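/- Let $(\mathbb T^2,g)$ be an oriented smooth Riemannian 2-torus, $f\in C^\infty(\mathbb T^2)$ and $\mathbf e$ a smooth vector field on $\mathbb T^2$. Put $\lambda(x,v)=f(x)+\langle \mathbf e(x),iv\rangle$ for a $g$-unit vector $v\in T_x\mathbb T^2$, where $i$ is the rotation through $\pi/2$ determined by $g$ and the orientation. Let $\phi_t$ be the flow on the unit circle bundle of $(\mathbb T^2,g)$ given by the unit speed solutions of $D_t\dot\gamma=\lambda(\gamma,\dot\gamma)\,i\dot\gamma$ ($D_t$ the Levi-Civita covariant derivative along $\gamma$), and let $\pi$ be the projection of this bundle onto $\mathbb T^2$. The exponential map of the thermostat $(\mathbb T^2,g,f,\mathbf e)$ at $x$ is the map $\exp_x^\lambda:T_x\mathbb T^2\to\mathbb T^2$ with $\exp^\lambda_x(tv)=\pi(\phi_t(x,v))$ for $t>0$ and $v$ a unit vector at $x$, and $\exp_x^\lambda(0)=x$. The thermostat has no conjugate points if, for every $x\in\mathbb T^2$, the map $\exp_x^\lambda$ is a ($C^1$) local diffeomorphism. Theorem. Let $U\in C^\infty(\mathbb T^2)$, and let $g_1=e^{-2U}g$, $f_1=e^{U}f$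 and $\mathbf e_1=e^{2U}(\mathbf e+\nabla U)$, where $\nabla U$ is the gradient of $U$ with respect to $g$ and $g_1$ carries the same orientation. Then the thermostat $(\mathbb T^2,g,f,\mathbf e)$ has no conjugate points if and only if the thermostat $(\mathbb T^2,g_1,f_1,\mathbf e_1)$ has no conjugate points. -/

import Mathlib

open scoped Matrix ContDiff Manifold Topology

noncomputable section

namespace Thermostat

/-- The 2-torus `ℝ² / ℤ²`. Translations trivialise its tangent bundle, so every tangent space is
`Plane`, and a vector field or a tensor field is given by its coefficient functions on the torus. -/
abbrev T2 : Type := UnitAddTorus (Fin 2)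

/-- The universal cover `ℝ²` of the torus, which is also each of its tangent spaces. -/
abbrev Plane : Type := Fin 2 → ℝ

/-- The covering map `ℝ² → ℝ² / ℤ²`. -/
def proj (p : Plane) : T2 := fun i => ((p i : ℝ) : UnitAddCircle)

/-- A function on the torus is `C^∞` if its pullback to `ℝ²` is. -/
def IsSmooth {F : Type*} [NormedAddCommGroup F] [NormedSpace ℝ F] (h : T2 → F) : Prop :=
  ContDiff ℝ ∞ (fun p : Plane => h (proj p))

/-- A smooth Riemannian metric, as the field of its Gram matrices `g i j = ⟨∂ᵢ, ∂ⱼ⟩`. -/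
structure IsRiemannianMetric (g : T2 → Matrix (Fin 2) (Fin 2) ℝ) : Prop where
  smooth : ∀ i j, IsSmooth (fun x => g x i j)
  posDef : ∀ x, (g x).PosDef

/-- The partial derivative `∂ᵢ h` of a function on the torus. -/
def partialDeriv (i : Fin 2) (h : T2 → ℝ) (x : T2) : ℝ :=
  deriv (fun t : ℝ => h (x + proj (t • Pi.single i 1))) 0

/-- The inner product `⟨v, w⟩` of two tangent vectors at `x`. -/
def metricInner (g : T2 → Matrix (Fin 2) (Fin 2) ℝ) (x : T2) (v w : Plane) : ℝ :=
  v ⬝ᵥ (g x *ᵥ w)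

/-- The length of a tangent vector at `x`. -/
def metricNorm (g : T2 → Matrix (Fin 2) (Fin 2) ℝ) (x : T2) (v : Plane) : ℝ :=
  √(metricInner g x v v)

/-- The gradient of `U` with respect to `g`: `(∇U)ⁱ = ∑ⱼ gⁱʲ ∂ⱼU`. -/
def gradient (g : T2 → Matrix (Fin 2) (Fin 2) ℝ) (U : T2 → ℝ) (x : T2) : Plane :=
  (g x)⁻¹ *ᵥ (fun j => partialDeriv j U x)

/-- The Christoffel symbols `Γᵏᵢⱼ` of the Levi-Civita connection of `g`. -/
def christoffel (g : T2 → Matrix (Fin 2) (Fin 2) ℝ) (x : T2) (k i j : Fin 2) : ℝ :=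
  (1 / 2) * ∑ l, (g x)⁻¹ k l *
    (partialDeriv i (fun y => g y j l) x + partialDeriv j (fun y => g y i l) x
      - partialDeriv l (fun y => g y i j) x)

open Classical in
/-- The sign of an orientation of the torus relative to the orientation by `(∂₀, ∂₁)`. -/
def orientationSign (o : Orientation ℝ Plane (Fin 2)) : ℝ :=
  if o = (Pi.basisFun ℝ (Fin 2)).orientation then 1 else -1

/-- The rotation `i` through `π/2` in the tangent plane at `x`, for the metric `g` and the
orientation `o`; see `metricInner_rot_right`, `metricInner_rot_rot` and `rot_oriented`. -/
def rot (o : Orientation ℝ Plane (Fin 2)) (g : T2 → Matrix (Fin 2) (Fin 2) ℝ) (x : T2)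
    (v : Plane) : Plane :=
  (orientationSign o / √((g x).det)) • ![-(g x *ᵥ v) 1, (g x *ᵥ v) 0]

/-- The function `λ(x, v) = f(x) + ⟨e(x), iv⟩`. -/
def thermostatLambda (o : Orientation ℝ Plane (Fin 2)) (g : T2 → Matrix (Fin 2) (Fin 2) ℝ)
    (f : T2 → ℝ) (e : T2 → Plane) (x : T2) (v : Plane) : ℝ :=
  f x + metricInner g x (e x) (rot o g x v)

/-- `(γ, v)` is an orbit of the thermostat on the unit circle bundle: `γ` is a unit speed curve in
the torus with velocity `v` and `D_t γ' = λ(γ, γ') i γ'`, where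
`(D_t γ')ᵏ = (vᵏ)' + ∑ᵢⱼ Γᵏᵢⱼ(γ) vⁱ vʲ`. The velocity is read off from a lift `c` of `γ` to `ℝ²`. -/
def IsThermostatOrbit (o : Orientation ℝ Plane (Fin 2)) (g : T2 → Matrix (Fin 2) (Fin 2) ℝ)
    (f : T2 → ℝ) (e : T2 → Plane) (γ : ℝ → T2) (v : ℝ → Plane) : Prop :=
  (∃ c : ℝ → Plane, (∀ t, proj (c t) = γ t) ∧ ∀ t, HasDerivAt c (v t) t) ∧
  (∀ t, metricNorm g (γ t) (v t) = 1) ∧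
  Differentiable ℝ v ∧
  ∀ t k, deriv v t k + ∑ i, ∑ j, christoffel g (γ t) k i j * v t i * v t j
    = thermostatLambda o g f e (γ t) (v t) * rot o g (γ t) (v t) k

open Classical in
/-- The flow `φ_t(x, v)` of the thermostat, for `v` a unit vector at `x`.
(The value at a vector that is not a unit vector is irrelevant.) -/
def thermostatFlow (o : Orientation ℝ Plane (Fin 2)) (g : T2 → Matrix (Fin 2) (Fin 2) ℝ)
    (f : T2 → ℝ) (e : T2 → Plane) (t : ℝ) (x : T2) (v : Plane) : T2 × Plane :=
  if h : ∃ q : (ℝ → T2) × (ℝ → Plane),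
      IsThermostatOrbit o g f e q.1 q.2 ∧ q.1 0 = x ∧ q.2 0 = v
  then (h.choose.1 t, h.choose.2 t)
  else (x, v)

open Classical in
/-- The exponential map of the thermostat at `x`: `exp_x(t v) = π(φ_t(x, v))` for `t > 0` and
`v` a unit vector at `x`, and `exp_x(0) = x`. -/
def thermostatExp (o : Orientation ℝ Plane (Fin 2)) (g : T2 → Matrix (Fin 2) (Fin 2) ℝ)
    (f : T2 → ℝ) (e : T2 → Plane) (x : T2) (w : Plane) : T2 :=
  if w = 0 then x
  else (thermostatFlow o g f e (metricNorm g x w) x ((metricNorm g x w)⁻¹ • w)).1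

/-- A map from a tangent plane to the torus is a local diffeomorphism if near every point it is the
composition of a local diffeomorphism of `ℝ²` with the covering map. The order of smoothness is `1`
because exponential maps of thermostats are in general only `C^1` at the origin (they are `C^∞`
elsewhere, where a `C^1` local diffeomorphism is then automatically a `C^∞` one). -/
def IsLocalDiffeoToTorus (F : Plane → T2) : Prop :=
  ∀ w, ∃ G : Plane → Plane, (∀ᶠ w' in 𝓝 w, F w' = proj (G w')) ∧
    IsLocalDiffeomorphAt 𝓘(ℝ, Plane) 𝓘(ℝ, Plane) 1 G w

/-- The thermostat `(T², g, f, e)` has no conjugate points. -/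
def NoConjugatePoints (o : Orientation ℝ Plane (Fin 2)) (g : T2 → Matrix (Fin 2) (Fin 2) ℝ)
    (f : T2 → ℝ) (e : T2 → Plane) : Prop :=
  ∀ x, IsLocalDiffeoToTorus (thermostatExp o g f e x)

lemma orientationSign_mul_self (o : Orientation ℝ Plane (Fin 2)) :
    orientationSign o * orientationSign o = 1 := by
  unfold orientationSign; split_ifs <;> norm_num

lemma metricInner_rot_right (o : Orientation ℝ Plane (Fin 2))
    (g : T2 → Matrix (Fin 2) (Fin 2) ℝ) (hg : IsRiemannianMetric g) (x : T2) (v : Plane) :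
    metricInner g x v (rot o g x v) = 0 := by
  have hs : g x 1 0 = g x 0 1 := by
    simpa using (hg.posDef x).isHermitian.apply 0 1
  simp [metricInner, rot, Matrix.mulVec, dotProduct, Fin.sum_univ_two, hs]
  ring

lemma metricInner_rot_rot (o : Orientation ℝ Plane (Fin 2))
    (g : T2 → Matrix (Fin 2) (Fin 2) ℝ) (hg : IsRiemannianMetric g) (x : T2) (v : Plane) :
    metricInner g x (rot o g x v) (rot o g x v) = metricInner g x v v := by
  have hs : g x 1 0 = g x 0 1 := by
    simpa using (hg.posDef x).isHermitian.apply 0 1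
  have hd : 0 < (g x).det := (hg.posDef x).det_pos
  have hq : √((g x).det) * √((g x).det) = (g x).det := Real.mul_self_sqrt hd.le
  have hq0 : √((g x).det) ≠ 0 := (Real.sqrt_pos.2 hd).ne'
  have ho := orientationSign_mul_self o
  have key : metricInner g x ![-(g x *ᵥ v) 1, (g x *ᵥ v) 0] ![-(g x *ᵥ v) 1, (g x *ᵥ v) 0]
      = (g x).det * metricInner g x v v := by
    simp [metricInner, Matrix.mulVec, dotProduct, Fin.sum_univ_two, Matrix.det_fin_two, hs]
    ring
  have h2 : metricInner g x (rot o g x v) (rot o g x v)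
      = (orientationSign o / √((g x).det)) * ((orientationSign o / √((g x).det)) *
        metricInner g x ![-(g x *ᵥ v) 1, (g x *ᵥ v) 0] ![-(g x *ᵥ v) 1, (g x *ᵥ v) 0]) := by
    simp only [metricInner, rot, Matrix.mulVec_smul, smul_dotProduct, dotProduct_smul, smul_eq_mul]
  rw [h2, key]
  have : (orientationSign o / √((g x).det)) * (orientationSign o / √((g x).det))
      = ((g x).det)⁻¹ := by
    rw [div_mul_div_comm, ho, hq, one_div]
  rw [← mul_assoc, this, ← mul_assoc, inv_mul_cancel₀ hd.ne', one_mul]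

lemma rot_oriented (o : Orientation ℝ Plane (Fin 2))
    (g : T2 → Matrix (Fin 2) (Fin 2) ℝ) (hg : IsRiemannianMetric g) (x : T2) (v : Plane)
    (b : Module.Basis (Fin 2) ℝ Plane) (hb : ⇑b = ![v, rot o g x v]) : b.orientation = o := by
  have hs : g x 1 0 = g x 0 1 := by
    simpa using (hg.posDef x).isHermitian.apply 0 1
  have hv : v ≠ 0 := by
    have h := b.ne_zero 0
    rw [hb] at h
    simpa using h
  have hpos : 0 < metricInner g x v v := by
    simpa [metricInner] using (hg.posDef x).dotProduct_mulVec_pos hv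
  have hd : 0 < √((g x).det) := Real.sqrt_pos.2 (hg.posDef x).det_pos
  have hdet : (Pi.basisFun ℝ (Fin 2)).det b
      = orientationSign o * (metricInner g x v v / √((g x).det)) := by
    rw [hb, Pi.basisFun_det_apply, Matrix.det_fin_two]
    simp [metricInner, rot, Matrix.mulVec, dotProduct, Fin.sum_univ_two, hs]
    ring
  have hq : 0 < metricInner g x v v / √((g x).det) := div_pos hpos hd
  have hcard : Fintype.card (Fin 2) = Module.finrank ℝ Plane := by simp
  by_cases ho : o = (Pi.basisFun ℝ (Fin 2)).orientation
  · rw [ho, eq_comm, Module.Basis.orientation_eq_iff_det_pos, hdet]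
    simpa [orientationSign, ho] using hq
  · have hneg : ¬ (0 < (Pi.basisFun ℝ (Fin 2)).det b) := by
      rw [hdet]
      simpa [orientationSign, ho] using hq.le
    rw [← Module.Basis.orientation_eq_iff_det_pos] at hneg
    have h1 := (Orientation.eq_or_eq_neg (Pi.basisFun ℝ (Fin 2)).orientation o hcard)
    have h2 := (Orientation.eq_or_eq_neg (Pi.basisFun ℝ (Fin 2)).orientation b.orientation hcard)
    rcases h1 with h1 | h1
    · exact absurd h1.symm ho
    rcases h2 with h2 | h2
    · exact absurd h2 hneg
    rw [h1] at h2
    exact (neg_injective h2).symm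

end Thermostat

end

/-! A conformal change keeps the unparametrised orbits: if `γ` is an orbit of the first thermostat,
the same curve run with arc length `s = ∫ e^{-U(γ)}` is an orbit of the second
(`IsThermostatOrbit.conformal`), because the `∇U` added to the field is exactly the change in
geodesic curvature. A `g`-unit vector `v` at `x` becomes the `g₁`-unit vector `e^{U(x)} v`, so the
old exponential map at `x` is the new one composed with the radial map `R(w) = (∫₀¹ F(σw) dσ) w`,
where `F(w) = e^{U(x)} e^{-U(exp_x w)}` (`thermostatExp_conformal_radialMap`).

If the old exponential map is a `C^1` local diffeomorphism, then `F` is `C^1`, and it is bounded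
below by a positive constant since the torus is compact. Hence `R` is a surjective local
diffeomorphism (`injective_fderiv_radialMap`, `surjective_radialMap`), and near `R(w)` the new
exponential map is the old one composed with a local inverse of `R`. The converse is the same
statement for `-U`, which undoes the change.

Completeness of the flow is not needed separately: a unit vector without an orbit would make the
exponential map constant along a ray, contrary to local injectivity at the origin. -/

noncomputable section

namespace Thermostat

/-! ### Radial maps and the inverse function theorem. -/

section Calculus

variable {E : Type*} [NormedAddCommGroup E] [NormedSpace ℝ E]

/-- A `C^1` map whose differentials are all injective is a local diffeomorphism. -/
lemma isLocalDiffeomorphAt_of_injective_fderiv [FiniteDimensional ℝ E] {f : E → E}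
    (hf : ContDiff ℝ 1 f) (hinj : ∀ x, Function.Injective (fderiv ℝ f x)) (x : E) :
    IsLocalDiffeomorphAt 𝓘(ℝ, E) 𝓘(ℝ, E) 1 f x := by
  have : CompleteSpace E := FiniteDimensional.complete ℝ E
  have key : ∀ y, ∃ A : E ≃L[ℝ] E, HasFDerivAt f (A : E →L[ℝ] E) y := by
    intro y
    refine ⟨(LinearEquiv.ofInjectiveEndo (fderiv ℝ f y : E →ₗ[ℝ] E)
      (hinj y)).toContinuousLinearEquiv, ?_⟩
    have h := (hf.differentiable one_ne_zero y).hasFDerivAt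
    convert h using 1
    ext z
    rfl
  obtain ⟨A, hA⟩ := key x
  let P := hf.contDiffAt.toOpenPartialHomeomorph f hA one_ne_zero
  have hP : (P : E → E) = f := rfl
  refine ⟨{ toPartialEquiv := P.toPartialEquiv
            open_source := P.open_source
            open_target := P.open_target
            contMDiffOn_toFun := ?_
            contMDiffOn_invFun := ?_ }, ?_, ?_⟩
  · exact hf.contMDiff.contMDiffOn
  · refine ContDiffOn.contMDiffOn fun y hy => ?_
    -- Smoothness of the inverse is needed on the whole target, hence invertible differentials at
    -- every point and not only at `x`.
    obtain ⟨B, hB⟩ := key (P.symm y)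
    exact (P.contDiffAt_symm hy hB hf.contDiffAt).contDiffWithinAt
  · exact hf.contDiffAt.mem_toOpenPartialHomeomorph_source hA one_ne_zero
  · intro y _
    rfl

/-- The average of `F` over the segment from `0` to `w`. -/
def radialMean (F : E → ℝ) (w : E) : ℝ := ∫ σ in (0 : ℝ)..1, F (σ • w)

/-- The radial map `w ↦ (∫₀¹ F (σ w) dσ) w`. -/
def radialMap (F : E → ℝ) (w : E) : E := radialMean F w • w

/-- Substituting `ρ = rσ` turns the mean into a primitive of `F` along the ray through `w`. -/
lemma smul_radialMean (F : E → ℝ) (w : E) (r : ℝ) :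
    r * radialMean F (r • w) = ∫ ρ in (0 : ℝ)..r, F (ρ • w) := by
  have h := intervalIntegral.mul_integral_comp_mul_right (a := 0) (b := 1) (c := r)
    (f := fun ρ => F (ρ • w))
  simp only [zero_mul, one_mul] at h
  rw [← h]
  simp [radialMean, smul_smul]

/-- Differentiation under the integral sign; the dominating constant comes from compactness of a
closed ball times `[0, 1]`. -/
lemma contDiff_radialMean [FiniteDimensional ℝ E] {F : E → ℝ} (hF : ContDiff ℝ 1 F) :
    ContDiff ℝ 1 (radialMean F) := by
  have hF' : Continuous (fderiv ℝ F) := hF.continuous_fderiv one_ne_zero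
  have hFc : Continuous F := hF.continuous
  have hD : Continuous (fun p : E × ℝ => p.2 • fderiv ℝ F (p.2 • p.1)) := by fun_prop
  rw [contDiff_one_iff_hasFDerivAt]
  refine ⟨fun w => ∫ σ in (0 : ℝ)..1, σ • fderiv ℝ F (σ • w), ?_, fun w => ?_⟩
  · exact intervalIntegral.continuous_parametric_intervalIntegral_of_continuous'
      (f := fun w σ => σ • fderiv ℝ F (σ • w)) hD 0 1
  · have hK : IsCompact (Metric.closedBall w 1 ×ˢ Set.Icc (0 : ℝ) 1) :=
      (isCompact_closedBall w 1).prod isCompact_Icc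
    obtain ⟨C, hC⟩ := hK.exists_bound_of_continuousOn hD.continuousOn
    refine intervalIntegral.hasFDerivAt_integral_of_dominated_of_fderiv_le
      (F := fun w σ => F (σ • w)) (F' := fun w σ => σ • fderiv ℝ F (σ • w))
      (bound := fun _ => C) (s := Metric.closedBall w 1)
      (Metric.closedBall_mem_nhds w one_pos) ?_ ?_ ?_ ?_ ?_ ?_
    · exact Filter.Eventually.of_forall fun y =>
        (by fun_prop : Continuous fun σ : ℝ => F (σ • y)).aestronglyMeasurable
    · exact (by fun_prop : Continuous fun σ : ℝ => F (σ • w)).intervalIntegrable _ _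
    · exact (by fun_prop : Continuous fun σ : ℝ =>
        σ • fderiv ℝ F (σ • w)).aestronglyMeasurable
    · refine Filter.Eventually.of_forall fun σ hσ y hy => ?_
      rw [Set.uIoc_of_le zero_le_one] at hσ
      exact hC (y, σ) ⟨hy, hσ.1.le, hσ.2⟩
    · exact intervalIntegrable_const
    · refine Filter.Eventually.of_forall fun σ _ y _ => ?_
      have h1 : HasFDerivAt (fun y : E => σ • y) (σ • ContinuousLinearMap.id ℝ E) y :=
        (hasFDerivAt_id y).const_smul σ
      have h2 := ((hF.differentiable one_ne_zero (σ • y)).hasFDerivAt).comp y h1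
      rwa [ContinuousLinearMap.comp_smul, ContinuousLinearMap.comp_id] at h2

lemma radialMean_pos {F : E → ℝ} (hF : Continuous F) (hpos : ∀ w, 0 < F w) (w : E) :
    0 < radialMean F w :=
  intervalIntegral.intervalIntegral_pos_of_pos
    ((by fun_prop : Continuous fun σ : ℝ => F (σ • w)).intervalIntegrable _ _)
    (fun _ => hpos _) one_pos

lemma contDiff_radialMap [FiniteDimensional ℝ E] {F : E → ℝ} (hF : ContDiff ℝ 1 F) :
    ContDiff ℝ 1 (radialMap F) :=
  (contDiff_radialMean hF).smul contDiff_id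

/-- The derivative of `r ↦ r * radialMean F (r • w)` at `1` is `F w`. -/
lemma fderiv_radialMean_self [FiniteDimensional ℝ E] {F : E → ℝ} (hF : ContDiff ℝ 1 F) (w : E) :
    radialMean F w + fderiv ℝ (radialMean F) w w = F w := by
  have hFc := hF.continuous
  -- The same derivative is computed twice: by the fundamental theorem of calculus here, by the
  -- product rule in `h2`.
  have h1 : HasDerivAt (fun r : ℝ => r * radialMean F (r • w)) (F w) 1 := by
    have hc : Continuous fun ρ : ℝ => F (ρ • w) := by fun_prop
    have h := intervalIntegral.integral_hasDerivAt_right (hc.intervalIntegrable 0 1)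
      hc.aestronglyMeasurable.stronglyMeasurableAtFilter hc.continuousAt
    simp only [one_smul] at h
    simpa only [smul_radialMean] using h
  have h2 : HasDerivAt (fun r : ℝ => r * radialMean F (r • w))
      (1 * radialMean F ((1 : ℝ) • w) + 1 * fderiv ℝ (radialMean F) w w) 1 := by
    refine (hasDerivAt_id (1 : ℝ)).mul ?_
    have h3 : HasDerivAt (fun r : ℝ => r • w) w 1 := by
      simpa using (hasDerivAt_id (1 : ℝ)).smul_const w
    have h4 : HasFDerivAt (radialMean F) (fderiv ℝ (radialMean F) w) ((1 : ℝ) • w) := by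
      rw [one_smul]
      exact ((contDiff_radialMean hF).differentiable one_ne_zero w).hasFDerivAt
    exact h4.comp_hasDerivAt (1 : ℝ) h3
  simpa using h2.unique h1

/-- With `m = radialMean F`, the differential at `w` is `u ↦ m(w) u + dm(u) w`. As `m(w) > 0`, a
kernel vector is a multiple of `w`, and the differential multiplies `w` by `F w > 0`. -/
lemma injective_fderiv_radialMap [FiniteDimensional ℝ E] {F : E → ℝ} (hF : ContDiff ℝ 1 F)
    (hpos : ∀ w, 0 < F w) (w : E) : Function.Injective (fderiv ℝ (radialMap F) w) := by
  rw [injective_iff_map_eq_zero]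
  intro u hu
  have hm : HasFDerivAt (radialMean F) (fderiv ℝ (radialMean F) w) w :=
    ((contDiff_radialMean hF).differentiable one_ne_zero w).hasFDerivAt
  have hd : fderiv ℝ (radialMap F) w u
      = radialMean F w • u + fderiv ℝ (radialMean F) w u • w := by
    have h := (hm.smul (hasFDerivAt_id w)).fderiv
    have h' : fderiv ℝ (radialMap F) w = _ := h
    rw [h']
    simp
  rw [hd] at hu
  have hmpos := radialMean_pos hF.continuous hpos w
  set a := fderiv ℝ (radialMean F) w u with ha
  have hu' : u = (-(a / radialMean F w)) • w := by
    have h1 : radialMean F w • u = -(a • w) := eq_neg_of_add_eq_zero_left hu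
    calc u = (radialMean F w)⁻¹ • (radialMean F w • u) := by
            rw [smul_smul, inv_mul_cancel₀ hmpos.ne', one_smul]
      _ = _ := by rw [h1, smul_neg, smul_smul, neg_smul, div_eq_inv_mul]
  have ha' : a = (-(a / radialMean F w)) * fderiv ℝ (radialMean F) w w := by
    conv_lhs => rw [ha, hu']
    simp
  have h2 : a * F w = 0 := by
    rw [← fderiv_radialMean_self hF w]
    have h3 : a * radialMean F w = -(a * fderiv ℝ (radialMean F) w w) := by
      conv_lhs => rw [ha']
      field_simp
    rw [mul_add, h3]
    ring
  have h4 : a = 0 := (mul_eq_zero.1 h2).resolve_right (hpos w).ne'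
  rw [hu', h4]
  simp

/-- The primitive of `F` along the ray through `w` is `0` at `0` and at least `1` at `c⁻¹`; where it
equals `1`, the point `r • w` is sent to `w`. -/
lemma surjective_radialMap {F : E → ℝ} (hF : Continuous F) {c : ℝ} (hc : 0 < c)
    (hFc : ∀ w, c ≤ F w) : Function.Surjective (radialMap F) := by
  intro w
  have hcont : Continuous fun ρ : ℝ => F (ρ • w) := by fun_prop
  have hcont' : Continuous fun r : ℝ => ∫ ρ in (0 : ℝ)..r, F (ρ • w) :=
    intervalIntegral.continuous_primitive (fun _ _ => hcont.intervalIntegrable _ _) 0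
  have hlow : 1 ≤ ∫ ρ in (0 : ℝ)..c⁻¹, F (ρ • w) := by
    have h := intervalIntegral.integral_mono_on (inv_pos.2 hc).le
      (intervalIntegrable_const (μ := MeasureTheory.volume) (c := c))
      (hcont.intervalIntegrable 0 c⁻¹)
      (fun ρ _ => hFc (ρ • w))
    simpa [inv_mul_cancel₀ hc.ne'] using h
  obtain ⟨r, -, hr⟩ := intermediate_value_Icc (inv_pos.2 hc).le hcont'.continuousOn
    (show (1 : ℝ) ∈ Set.Icc _ _ from ⟨by simp, hlow⟩)
  refine ⟨r • w, ?_⟩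
  rw [radialMap, smul_smul, mul_comm, smul_radialMean]
  change (∫ ρ in (0 : ℝ)..r, F (ρ • w)) = 1 at hr
  rw [hr, one_smul]

end Calculus

/-! ### Lifts to the plane and derivatives on the torus. -/

section Torus

lemma proj_zero : proj 0 = 0 := by
  ext i; simp [proj]

lemma proj_add (p q : Plane) : proj (p + q) = proj p + proj q := by
  ext i; simp [proj]

lemma proj_sub (p q : Plane) : proj (p - q) = proj p - proj q := by
  ext i; simp [proj]

/-- Every point of the torus has a lift in the unit square. -/
lemma exists_mem_Icc_proj_eq (x : T2) : ∃ p ∈ Set.Icc (0 : Plane) 1, proj p = x := by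
  have h : ∀ i, ∃ b ∈ Set.Ico (0 : ℝ) 1, x i = (b : UnitAddCircle) := by
    intro i
    obtain ⟨b, hb, hb'⟩ := AddCircle.eq_coe_Ico (x i)
    exact ⟨b, hb, hb'.symm⟩
  choose p hp hpx using h
  exact ⟨p, ⟨fun i => (hp i).1, fun i => (hp i).2.le⟩, funext fun i => (hpx i).symm⟩

lemma proj_surjective : Function.Surjective proj := fun x =>
  let ⟨p, _, hp⟩ := exists_mem_Icc_proj_eq x
  ⟨p, hp⟩

lemma eq_of_proj_eq {p q : Plane} (h : proj p = proj q) (hpq : dist p q < 1) : p = q := by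
  funext i
  have h1 : ((p i - q i : ℝ) : UnitAddCircle) = 0 := by
    have := congrFun h i
    simp only [proj] at this
    rw [AddCircle.coe_sub, this, sub_self]
  obtain ⟨n, hn⟩ := (AddCircle.coe_eq_zero_iff (1 : ℝ)).1 h1
  have h2 : |p i - q i| < 1 := by
    rw [← Real.dist_eq]
    exact (dist_le_pi_dist p q i).trans_lt hpq
  rw [← hn, zsmul_eq_mul, mul_one] at h2
  have h3 : n = 0 := Int.abs_lt_one_iff.1 (by exact_mod_cast h2)
  rw [h3, zero_smul] at hn
  linarith

lemma IsSmooth.contDiff {F : Type*} [NormedAddCommGroup F] [NormedSpace ℝ F] {h : T2 → F}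
    (hh : IsSmooth h) : ContDiff ℝ ∞ (fun p : Plane => h (proj p)) := hh

lemma IsSmooth.differentiable {F : Type*} [NormedAddCommGroup F] [NormedSpace ℝ F] {h : T2 → F}
    (hh : IsSmooth h) : Differentiable ℝ (fun p : Plane => h (proj p)) :=
  hh.contDiff.differentiable (by simp)

/-- The minimum of the pullback over the compact unit square serves, since the square covers the
torus. -/
lemma IsSmooth.exists_lower_bound {h : T2 → ℝ} (hh : IsSmooth h) (hpos : ∀ x, 0 < h x) :
    ∃ c, 0 < c ∧ ∀ x, c ≤ h x := by
  obtain ⟨p, -, hp⟩ := (isCompact_Icc (a := (0 : Plane)) (b := 1)).exists_isMinOn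
    ⟨0, by simp⟩ hh.contDiff.continuous.continuousOn
  refine ⟨h (proj p), hpos _, fun x => ?_⟩
  obtain ⟨q, hq, rfl⟩ := exists_mem_Icc_proj_eq x
  exact hp hq

lemma partialDeriv_proj {h : T2 → ℝ} (hh : IsSmooth h) (i : Fin 2) (p : Plane) :
    partialDeriv i h (proj p) = fderiv ℝ (fun q : Plane => h (proj q)) p (Pi.single i 1) := by
  have h1 : HasDerivAt (fun t : ℝ => p + t • (Pi.single i 1 : Plane)) (Pi.single i 1) 0 := by
    simpa using ((hasDerivAt_id (0 : ℝ)).smul_const (Pi.single i 1 : Plane)).const_add p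
  have h2 : HasFDerivAt (fun q : Plane => h (proj q)) (fderiv ℝ (fun q : Plane => h (proj q)) p)
      (p + (0 : ℝ) • (Pi.single i 1 : Plane)) := by
    rw [zero_smul, add_zero]
    exact (hh.differentiable p).hasFDerivAt
  have h3 := (h2.comp_hasDerivAt (0 : ℝ) h1).deriv
  simpa only [partialDeriv, Function.comp_def, proj_add] using h3

lemma fderiv_proj_apply {h : T2 → ℝ} (hh : IsSmooth h) (p v : Plane) :
    fderiv ℝ (fun q : Plane => h (proj q)) p v = ∑ i, partialDeriv i h (proj p) * v i := by
  conv_lhs => rw [pi_eq_sum_univ' v]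
  simp only [map_sum, map_smul, partialDeriv_proj hh, smul_eq_mul]
  refine Finset.sum_congr rfl fun i _ => ?_
  rw [mul_comm]

lemma IsSmooth.partialDeriv {h : T2 → ℝ} (hh : IsSmooth h) (i : Fin 2) :
    IsSmooth (partialDeriv i h) := by
  have h1 : (fun p : Plane => Thermostat.partialDeriv i h (proj p))
      = fun p => fderiv ℝ (fun q : Plane => h (proj q)) p (Pi.single i 1) :=
    funext (partialDeriv_proj hh i)
  rw [IsSmooth, h1]
  exact (hh.contDiff.fderiv_right (m := ∞) (by simp)).clm_apply contDiff_const

lemma IsSmooth.hasDerivAt {h : T2 → ℝ} (hh : IsSmooth h) (i : Fin 2) (x : T2) :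
    HasDerivAt (fun t : ℝ => h (x + proj (t • Pi.single i 1))) (Thermostat.partialDeriv i h x) 0 := by
  obtain ⟨p, rfl⟩ := proj_surjective x
  refine DifferentiableAt.hasDerivAt ?_
  simp only [← proj_add]
  have := hh.differentiable
  exact (this _).comp (0 : ℝ) (by fun_prop : DifferentiableAt ℝ
    (fun t : ℝ => p + t • (Pi.single i 1 : Plane)) 0)

end Torus

/-! ### Smoothness and positivity of the metric data. -/

section Metric

variable {g : T2 → Matrix (Fin 2) (Fin 2) ℝ}

lemma IsRiemannianMetric.det_pos (hg : IsRiemannianMetric g) (x : T2) : 0 < (g x).det :=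
  (hg.posDef x).det_pos

lemma IsRiemannianMetric.symm (hg : IsRiemannianMetric g) (x : T2) : g x 1 0 = g x 0 1 := by
  simpa using (hg.posDef x).isHermitian.apply 0 1

lemma IsRiemannianMetric.symm' (hg : IsRiemannianMetric g) (x : T2) (i j : Fin 2) :
    g x i j = g x j i := by
  simpa using (hg.posDef x).isHermitian.apply j i

lemma IsRiemannianMetric.isUnit_det (hg : IsRiemannianMetric g) (x : T2) :
    IsUnit (g x).det := (hg.det_pos x).ne'.isUnit

lemma IsRiemannianMetric.smooth_det (hg : IsRiemannianMetric g) :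
    IsSmooth (fun x => (g x).det) := by
  have h := fun i j => (hg.smooth i j).contDiff
  simp only [IsSmooth, Matrix.det_fin_two]
  exact ((h 0 0).mul (h 1 1)).sub ((h 0 1).mul (h 1 0))

lemma IsRiemannianMetric.smooth_inv (hg : IsRiemannianMetric g) (i j : Fin 2) :
    IsSmooth (fun x => (g x)⁻¹ i j) := by
  have h := fun i j => (hg.smooth i j).contDiff
  have hd : ContDiff ℝ ∞ (fun p => ((g (proj p)).det)⁻¹) :=
    hg.smooth_det.contDiff.inv fun p => (hg.det_pos (proj p)).ne'
  simp only [IsSmooth, Matrix.inv_def, Matrix.adjugate_fin_two, Ring.inverse_eq_inv',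
    Matrix.smul_apply, smul_eq_mul]
  refine hd.mul ?_
  fin_cases i <;> fin_cases j
  · exact h 1 1
  · exact (h 0 1).neg
  · exact (h 1 0).neg
  · exact h 0 0

lemma IsRiemannianMetric.smooth_christoffel (hg : IsRiemannianMetric g) (k i j : Fin 2) :
    IsSmooth (fun x => christoffel g x k i j) := by
  have h := fun i j l => ((hg.smooth j l).partialDeriv i).contDiff
  refine contDiff_const.mul (ContDiff.sum fun l _ => ?_)
  exact (hg.smooth_inv k l).contDiff.mul (((h i j l).add (h j i l)).sub (h l i j))

lemma IsRiemannianMetric.smooth_gradient (hg : IsRiemannianMetric g) {U : T2 → ℝ}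
    (hU : IsSmooth U) : IsSmooth (gradient g U) := by
  refine contDiff_pi.2 fun k => ?_
  simp only [gradient, Matrix.mulVec, dotProduct]
  exact ContDiff.sum fun l _ => (hg.smooth_inv k l).contDiff.mul (hU.partialDeriv l).contDiff

lemma metricInner_pos (hg : IsRiemannianMetric g) (x : T2) {v : Plane} (hv : v ≠ 0) :
    0 < metricInner g x v v := by
  simpa [metricInner] using (hg.posDef x).dotProduct_mulVec_pos hv

lemma metricNorm_pos (hg : IsRiemannianMetric g) (x : T2) {v : Plane} (hv : v ≠ 0) :
    0 < metricNorm g x v := Real.sqrt_pos.2 (metricInner_pos hg x hv)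

lemma metricNorm_smul (x : T2) {a : ℝ} (ha : 0 ≤ a) (v : Plane) :
    metricNorm g x (a • v) = a * metricNorm g x v := by
  have h : metricInner g x (a • v) (a • v) = a ^ 2 * metricInner g x v v := by
    simp only [metricInner, Matrix.mulVec_smul, smul_dotProduct, dotProduct_smul, smul_eq_mul]
    ring
  rw [metricNorm, metricNorm, h, Real.sqrt_mul (sq_nonneg a), Real.sqrt_sq ha]

end Metric

/-! ### Uniqueness of thermostat orbits. -/

section Uniqueness

/-- Global solutions of an autonomous ODE with `C^1` right hand side are determined by their
initial values. -/
lemma eq_of_hasDerivAt_of_contDiff {E : Type*} [NormedAddCommGroup E] [NormedSpace ℝ E]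
    [FiniteDimensional ℝ E] {X : E → E} (hX : ContDiff ℝ 1 X) {α β : ℝ → E}
    (hα : ∀ t, HasDerivAt α (X (α t)) t) (hβ : ∀ t, HasDerivAt β (X (β t)) t)
    (h0 : α 0 = β 0) : α = β := by
  have : ProperSpace E := FiniteDimensional.proper ℝ E
  funext t
  have hαc : Continuous α := continuous_iff_continuousAt.2 fun s => (hα s).continuousAt
  have hβc : Continuous β := continuous_iff_continuousAt.2 fun s => (hβ s).continuousAt
  set T := |t| + 1 with hT
  -- `X` need not be globally Lipschitz, but over `[-T, T]` both curves stay in one closed ball, on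
  -- which it is.
  have hK : IsCompact (α '' Set.Icc (-T) T ∪ β '' Set.Icc (-T) T) :=
    (isCompact_Icc.image hαc).union (isCompact_Icc.image hβc)
  obtain ⟨R, hR⟩ := hK.isBounded.subset_closedBall (0 : E)
  obtain ⟨K, hKL⟩ := (hX.contDiffOn (s := Metric.closedBall (0 : E) R)).exists_lipschitzOnWith
    one_ne_zero (convex_closedBall 0 R) (isCompact_closedBall 0 R)
  have htpos : 0 < T := by positivity
  refine ODE_solution_unique_of_mem_Icc (v := fun _ => X) (K := K)
    (s := fun _ => Metric.closedBall (0 : E) R) (a := -T) (b := T) (t₀ := 0)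
    (fun _ _ => hKL) ⟨by linarith, htpos⟩ hαc.continuousOn (fun s _ => hα s)
    (fun s hs => hR (Or.inl ⟨s, Set.Ioo_subset_Icc_self hs, rfl⟩)) hβc.continuousOn
    (fun s _ => hβ s) (fun s hs => hR (Or.inr ⟨s, Set.Ioo_subset_Icc_self hs, rfl⟩)) h0 ?_
  exact ⟨by have := neg_abs_le t; linarith, by have := le_abs_self t; linarith⟩

variable (o : Orientation ℝ Plane (Fin 2)) (g : T2 → Matrix (Fin 2) (Fin 2) ℝ)
  (f : T2 → ℝ) (e : T2 → Plane)

/-- The vector field on `ℝ² × ℝ²` whose integral curves are the lifts of the thermostat orbits. -/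
def thermostatField (q : Plane × Plane) : Plane × Plane :=
  (q.2, fun k => thermostatLambda o g f e (proj q.1) q.2 * rot o g (proj q.1) q.2 k
    - ∑ i, ∑ j, christoffel g (proj q.1) k i j * q.2 i * q.2 j)

variable {g f e}

lemma contDiff_thermostatField (hg : IsRiemannianMetric g) (hf : IsSmooth f) (he : IsSmooth e) :
    ContDiff ℝ ∞ (thermostatField o g f e) := by
  have hp {F : Type} [NormedAddCommGroup F] [NormedSpace ℝ F] {h : T2 → F} (hh : IsSmooth h) :
      ContDiff ℝ ∞ (fun q : Plane × Plane => h (proj q.1)) := hh.contDiff.comp contDiff_fst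
  have hv (i : Fin 2) : ContDiff ℝ ∞ (fun q : Plane × Plane => q.2 i) :=
    (contDiff_apply ℝ ℝ i).comp contDiff_snd
  have hgv (i : Fin 2) :
      ContDiff ℝ ∞ (fun q : Plane × Plane => (g (proj q.1) *ᵥ q.2) i) := by
    simp only [Matrix.mulVec, dotProduct]
    exact ContDiff.sum fun j _ => (hp (hg.smooth i j)).mul (hv j)
  have hd : ContDiff ℝ ∞
      (fun q : Plane × Plane => orientationSign o / √((g (proj q.1)).det)) :=
    contDiff_const.div ((hp hg.smooth_det).sqrt fun q => (hg.det_pos _).ne')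
      fun q => (Real.sqrt_pos.2 (hg.det_pos _)).ne'
  have hrot (k : Fin 2) : ContDiff ℝ ∞ (fun q : Plane × Plane => rot o g (proj q.1) q.2 k) := by
    simp only [rot, Pi.smul_apply, smul_eq_mul]
    refine hd.mul ?_
    fin_cases k
    · exact (hgv 1).neg
    · exact hgv 0
  have hlam : ContDiff ℝ ∞
      (fun q : Plane × Plane => thermostatLambda o g f e (proj q.1) q.2) := by
    simp only [thermostatLambda, metricInner, Matrix.mulVec, dotProduct]
    refine (hp hf).add (ContDiff.sum fun i _ => ?_)
    refine ((contDiff_apply ℝ ℝ i).comp (hp he)).mul (ContDiff.sum fun j _ => ?_)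
    exact (hp (hg.smooth i j)).mul (hrot j)
  refine contDiff_snd.prodMk (contDiff_pi.2 fun k => ?_)
  refine (hlam.mul (hrot k)).sub (ContDiff.sum fun i _ => ContDiff.sum fun j _ => ?_)
  exact ((hp (hg.smooth_christoffel k i j)).mul (hv i)).mul (hv j)

variable {o}

lemma IsThermostatOrbit.exists_lift {γ : ℝ → T2} {v : ℝ → Plane}
    (h : IsThermostatOrbit o g f e γ v) {p : Plane} (hp : proj p = γ 0) :
    ∃ c : ℝ → Plane, c 0 = p ∧ (∀ t, proj (c t) = γ t) ∧
      ∀ t, HasDerivAt (fun t => (c t, v t)) (thermostatField o g f e (c t, v t)) t := by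
  obtain ⟨⟨c, hc, hcv⟩, -, hv, hode⟩ := h
  -- Translation by `p - c 0`, which projects to `0`, moves the lift to the prescribed starting
  -- point.
  refine ⟨fun t => c t + (p - c 0), by simp, fun t => ?_, fun t => ?_⟩
  · rw [proj_add, proj_sub, hp, hc, hc, sub_self, add_zero]
  · refine ((hcv t).add_const _).prodMk ?_
    convert (hv t).hasDerivAt using 1
    funext k
    have hct : proj (c t + (p - c 0)) = γ t := by
      rw [proj_add, proj_sub, hp, hc, hc, sub_self, add_zero]
    simp only [hct]
    rw [← hode t k]
    ring

/-- An orbit of a thermostat is determined by its initial point and velocity. -/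
lemma IsThermostatOrbit.unique (hg : IsRiemannianMetric g) (hf : IsSmooth f) (he : IsSmooth e)
    {γ γ' : ℝ → T2} {v v' : ℝ → Plane} (h : IsThermostatOrbit o g f e γ v)
    (h' : IsThermostatOrbit o g f e γ' v') (h0 : γ 0 = γ' 0) (hv0 : v 0 = v' 0) : γ = γ' := by
  obtain ⟨p, hp⟩ := proj_surjective (γ 0)
  obtain ⟨c, hc0, hc, hcd⟩ := h.exists_lift hp
  obtain ⟨c', hc0', hc', hcd'⟩ := h'.exists_lift (hp.trans h0)
  have key := eq_of_hasDerivAt_of_contDiff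
    ((contDiff_thermostatField o hg hf he).of_le (by simp)) hcd hcd' (by simp [hc0, hc0', hv0])
  funext t
  rw [← hc, ← hc']
  exact congrArg (fun q => proj q.1) (congrFun key t)

end Uniqueness

/-! ### Orbits under a conformal change. -/

section Conformal

variable {o : Orientation ℝ Plane (Fin 2)} {g : T2 → Matrix (Fin 2) (Fin 2) ℝ} {U : T2 → ℝ}

/-- The conformal metric `e^{-2U} g`. -/
def conformalMetric (g : T2 → Matrix (Fin 2) (Fin 2) ℝ) (U : T2 → ℝ) (x : T2) :
    Matrix (Fin 2) (Fin 2) ℝ := Real.exp (-2 * U x) • g x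

/-- The function `e^U f`. -/
def conformalFunction (f : T2 → ℝ) (U : T2 → ℝ) (x : T2) : ℝ := Real.exp (U x) * f x

/-- The vector field `e^{2U} (e + ∇U)`. -/
def conformalField (g : T2 → Matrix (Fin 2) (Fin 2) ℝ) (e : T2 → Plane) (U : T2 → ℝ) (x : T2) :
    Plane := Real.exp (2 * U x) • (e x + gradient g U x)

lemma exp_two_mul_mul_exp_neg (a : ℝ) : Real.exp (2 * a) * Real.exp (-2 * a) = 1 := by
  rw [← Real.exp_add]; simp

lemma isRiemannianMetric_conformalMetric (hg : IsRiemannianMetric g) (hU : IsSmooth U) :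
    IsRiemannianMetric (conformalMetric g U) where
  smooth i j := (contDiff_const.mul hU.contDiff).exp.mul (hg.smooth i j).contDiff
  posDef x := (hg.posDef x).smul (Real.exp_pos _)

lemma isSmooth_conformalFunction {f : T2 → ℝ} (hf : IsSmooth f) (hU : IsSmooth U) :
    IsSmooth (conformalFunction f U) := hU.contDiff.exp.mul hf.contDiff

lemma isSmooth_conformalField {e : T2 → Plane} (hg : IsRiemannianMetric g) (he : IsSmooth e)
    (hU : IsSmooth U) : IsSmooth (conformalField g e U) :=
  (contDiff_const.mul hU.contDiff).exp.smul (he.contDiff.add (hg.smooth_gradient hU).contDiff)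

lemma conformalMetric_inv (hg : IsRiemannianMetric g) (x : T2) :
    (conformalMetric g U x)⁻¹ = Real.exp (2 * U x) • (g x)⁻¹ := by
  refine Matrix.inv_eq_left_inv ?_
  rw [conformalMetric, Matrix.smul_mul, Matrix.mul_smul, smul_smul, exp_two_mul_mul_exp_neg,
    one_smul, Matrix.nonsing_inv_mul _ (hg.isUnit_det x)]

lemma metricInner_conformalMetric (x : T2) (v w : Plane) :
    metricInner (conformalMetric g U) x v w = Real.exp (-2 * U x) * metricInner g x v w := by
  simp only [metricInner, conformalMetric, Matrix.smul_mulVec, dotProduct_smul, smul_eq_mul]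

lemma metricNorm_conformalMetric (x : T2) (v : Plane) :
    metricNorm (conformalMetric g U) x v = Real.exp (-U x) * metricNorm g x v := by
  have h : Real.exp (-2 * U x) = Real.exp (-U x) ^ 2 := by
    rw [← Real.exp_nat_mul]; congr 1; push_cast; ring
  rw [metricNorm, metricNorm, metricInner_conformalMetric, Real.sqrt_mul (Real.exp_pos _).le, h,
    Real.sqrt_sq (Real.exp_pos _).le]

/-- In dimension two `√det` scales by `e^{-2U}`, like the metric, so the factors cancel. -/
lemma rot_conformalMetric (x : T2) (v : Plane) : rot o (conformalMetric g U) x v = rot o g x v := by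
  have hd : √((conformalMetric g U x).det) = Real.exp (-2 * U x) * √((g x).det) := by
    rw [conformalMetric, Matrix.det_smul, Fintype.card_fin, Real.sqrt_mul (by positivity),
      Real.sqrt_sq (Real.exp_pos _).le]
  have he := (Real.exp_pos (-2 * U x)).ne'
  rw [rot, rot, hd]
  funext k
  have hs (a : ℝ) : orientationSign o / (Real.exp (-2 * U x) * √((g x).det))
      * (Real.exp (-2 * U x) * a) = orientationSign o / √((g x).det) * a := by
    rw [← mul_assoc, div_mul_eq_mul_div, mul_comm (orientationSign o),
      mul_div_mul_left _ _ he]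
  simp only [conformalMetric, Matrix.smul_mulVec, Pi.smul_apply, smul_eq_mul]
  fin_cases k
  · have h := hs (-(g x *ᵥ v) 1)
    rw [mul_neg (Real.exp _)] at h
    exact h
  · exact hs ((g x *ᵥ v) 0)

lemma rot_smul (x : T2) (a : ℝ) (v : Plane) : rot o g x (a • v) = a • rot o g x v := by
  funext k
  fin_cases k <;> simp [rot, Matrix.mulVec_smul] <;> ring

lemma metricInner_gradient (hg : IsRiemannianMetric g) (x : T2) (w : Plane) :
    metricInner g x (gradient g U x) w = ∑ i, partialDeriv i U x * w i := by
  have hT : (g x)ᵀ = g x := by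
    ext i j
    exact hg.symm' x j i
  rw [metricInner, gradient, Matrix.dotProduct_mulVec, ← Matrix.mulVec_transpose, hT,
    Matrix.mulVec_mulVec, Matrix.mul_nonsing_inv _ (hg.isUnit_det x), Matrix.one_mulVec]
  rfl

/-- Expansion of a vector in the orthogonal frame `(v, iv)`. -/
lemma metricInner_smul_eq (hg : IsRiemannianMetric g) (x : T2) (u v : Plane) :
    metricInner g x v v • u
      = metricInner g x u v • v + metricInner g x u (rot o g x v) • rot o g x v := by
  have hd := hg.det_pos x
  have hq : √((g x).det) * √((g x).det) = (g x).det := Real.mul_self_sqrt hd.le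
  have hr : (orientationSign o / √((g x).det)) * (orientationSign o / √((g x).det))
      = ((g x).det)⁻¹ := by
    rw [div_mul_div_comm, orientationSign_mul_self, hq, one_div]
  set r := orientationSign o / √((g x).det) with hrdef
  have h1 : metricInner g x u (rot o g x v) • rot o g x v
      = (((g x).det)⁻¹ * metricInner g x u ![-(g x *ᵥ v) 1, (g x *ᵥ v) 0])
        • ![-(g x *ᵥ v) 1, (g x *ᵥ v) 0] := by
    simp only [rot, ← hrdef, metricInner, Matrix.mulVec_smul, dotProduct_smul, smul_smul, ← hr,
      smul_eq_mul]
    congr 1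
    ring
  have hd' := hd.ne'
  have hD := Matrix.det_fin_two (g x)
  rw [h1]
  generalize (g x).det = D at hd' hD
  rw [hg.symm] at hD
  funext k
  fin_cases k <;>
  · simp [metricInner, Matrix.mulVec, dotProduct, Fin.sum_univ_two, hg.symm]
    field_simp
    rw [hD]
    ring

lemma partialDeriv_conformalMetric (hg : IsRiemannianMetric g) (hU : IsSmooth U) (x : T2)
    (i j l : Fin 2) : partialDeriv i (fun y => conformalMetric g U y j l) x
      = Real.exp (-2 * U x) * (partialDeriv i (fun y => g y j l) x
        - 2 * partialDeriv i U x * g x j l) := by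
  have h := (((hU.hasDerivAt i x).const_mul (-2)).exp.mul ((hg.smooth j l).hasDerivAt i x)).deriv
  rw [zero_smul, proj_zero, add_zero] at h
  refine h.trans ?_
  ring

lemma IsRiemannianMetric.sum_inv_mul (hg : IsRiemannianMetric g) (x : T2) (k j : Fin 2) :
    ∑ l, (g x)⁻¹ k l * g x j l = if k = j then 1 else 0 := by
  have h := congrFun (congrFun (Matrix.nonsing_inv_mul _ (hg.isUnit_det x)) k) j
  rw [Matrix.mul_apply, Matrix.one_apply] at h
  rw [← h]
  exact Finset.sum_congr rfl fun l _ => by rw [hg.symm' x j l]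

/-- The factors `e^{2U}` and `e^{-2U}` cancel, and differentiating the conformal factor leaves three
terms: two contract `g⁻¹` with `g`, the third raises the index of `dU`. -/
lemma christoffel_conformalMetric (hg : IsRiemannianMetric g) (hU : IsSmooth U) (x : T2)
    (k i j : Fin 2) : christoffel (conformalMetric g U) x k i j
      = christoffel g x k i j - partialDeriv i U x * (if k = j then 1 else 0)
        - partialDeriv j U x * (if k = i then 1 else 0) + g x i j * gradient g U x k := by
  have hexp := exp_two_mul_mul_exp_neg (U x)
  rw [← hg.sum_inv_mul x k j, ← hg.sum_inv_mul x k i]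
  simp only [christoffel, conformalMetric_inv hg, partialDeriv_conformalMetric hg hU, gradient,
    Matrix.mulVec, dotProduct, Matrix.smul_apply, smul_eq_mul, Fin.sum_univ_two]
  linear_combination
    (1 / 2 * ((g x)⁻¹ k 0 * (partialDeriv i (fun y => g y j 0) x
        - 2 * partialDeriv i U x * g x j 0 + (partialDeriv j (fun y => g y i 0) x
        - 2 * partialDeriv j U x * g x i 0) - (partialDeriv 0 (fun y => g y i j) x
        - 2 * partialDeriv 0 U x * g x i j))
      + (g x)⁻¹ k 1 * (partialDeriv i (fun y => g y j 1) x
        - 2 * partialDeriv i U x * g x j 1 + (partialDeriv j (fun y => g y i 1) x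
        - 2 * partialDeriv j U x * g x i 1) - (partialDeriv 1 (fun y => g y i j) x
        - 2 * partialDeriv 1 U x * g x i j)))) * hexp

lemma sum_christoffel_conformalMetric (hg : IsRiemannianMetric g) (hU : IsSmooth U) (x : T2)
    (k : Fin 2) (v : Plane) :
    ∑ i, ∑ j, christoffel (conformalMetric g U) x k i j * v i * v j
      = ∑ i, ∑ j, christoffel g x k i j * v i * v j
        - 2 * (∑ i, partialDeriv i U x * v i) * v k
        + metricInner g x v v * gradient g U x k := by
  simp only [christoffel_conformalMetric hg hU, metricInner, Matrix.mulVec, dotProduct,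
    Fin.sum_univ_two]
  fin_cases k <;> simp <;> ring

lemma thermostatLambda_conformal {f : T2 → ℝ} {e : T2 → Plane} (x : T2) (v : Plane) :
    thermostatLambda o (conformalMetric g U) (conformalFunction f U) (conformalField g e U) x
      (Real.exp (U x) • v)
      = Real.exp (U x) * (thermostatLambda o g f e x v
        + metricInner g x (gradient g U x) (rot o g x v)) := by
  have hexp := exp_two_mul_mul_exp_neg (U x)
  rw [thermostatLambda, thermostatLambda, metricInner_conformalMetric, rot_conformalMetric,
    rot_smul, conformalFunction, conformalField]
  simp only [metricInner, Matrix.mulVec_smul, smul_dotProduct, dotProduct_smul, smul_eq_mul,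
    add_dotProduct]
  linear_combination (Real.exp (U x) * (e x ⬝ᵥ g x *ᵥ rot o g x v
    + gradient g U x ⬝ᵥ g x *ᵥ rot o g x v)) * hexp

/-- A thermostat orbit becomes an orbit of the conformally changed thermostat when it is
reparametrised to unit speed for the conformal metric. -/
lemma IsThermostatOrbit.conformal {f : T2 → ℝ} {e : T2 → Plane} (hg : IsRiemannianMetric g)
    (hU : IsSmooth U) {γ : ℝ → T2} {v : ℝ → Plane} (h : IsThermostatOrbit o g f e γ v)
    {τ : ℝ → ℝ} (hτ : ∀ s, HasDerivAt τ (Real.exp (U (γ (τ s)))) s) :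
    IsThermostatOrbit o (conformalMetric g U) (conformalFunction f U) (conformalField g e U)
      (fun s => γ (τ s)) (fun s => Real.exp (U (γ (τ s))) • v (τ s)) := by
  obtain ⟨⟨c, hc, hcv⟩, hv1, hv, hode⟩ := h
  have hcτ (s : ℝ) : HasDerivAt (fun s => c (τ s)) (Real.exp (U (γ (τ s))) • v (τ s)) s :=
    (hcv (τ s)).scomp s (hτ s)
  have hUτ (s : ℝ) : HasDerivAt (fun s => U (γ (τ s)))
      (Real.exp (U (γ (τ s))) * ∑ i, partialDeriv i U (γ (τ s)) * v (τ s) i) s := by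
    have h1 := (hU.differentiable (c (τ s))).hasFDerivAt.comp_hasDerivAt s (hcτ s)
    rw [map_smul, fderiv_proj_apply hU, hc, smul_eq_mul] at h1
    simpa only [Function.comp_def, hc] using h1
  have hvτ (s : ℝ) := (hUτ s).exp.smul ((hv (τ s)).hasDerivAt.scomp s (hτ s))
  refine ⟨⟨fun s => c (τ s), fun s => hc (τ s), hcτ⟩, fun s => ?_,
    fun s => (hvτ s).differentiableAt, fun s k => ?_⟩
  · rw [metricNorm_conformalMetric, metricNorm_smul _ (Real.exp_pos _).le, hv1, mul_one,
      ← Real.exp_add, neg_add_cancel, Real.exp_zero]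
  · have hinner : metricInner g (γ (τ s)) (v (τ s)) (v (τ s)) = 1 := by
      have h1 := hv1 (τ s)
      rwa [metricNorm, Real.sqrt_eq_one] at h1
    -- Up to the factor `e^{2U}`, rescaling the velocity contributes `dU(v) v` and the Christoffel
    -- symbols contribute `-2 dU(v) v + ∇U`. In the frame `(v, iv)` the sum is `⟨∇U, iv⟩ iv`, which
    -- is what the term `∇U` in the new field supplies.
    have hframe := congrFun (metricInner_smul_eq (o := o) hg (γ (τ s))
      (gradient g U (γ (τ s))) (v (τ s))) k
    rw [hinner, metricInner_gradient hg _ (v (τ s))] at hframe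
    have hdv : deriv (fun s => Real.exp (U (γ (τ s))) • v (τ s)) s = _ := (hvτ s).deriv
    rw [hdv, thermostatLambda_conformal, rot_conformalMetric, rot_smul,
      sum_christoffel_conformalMetric hg hU]
    have hode' := hode (τ s) k
    simp only [metricInner] at hinner
    simp only [metricInner, Pi.add_apply, Pi.smul_apply, smul_eq_mul, Function.comp_apply,
      Matrix.mulVec_smul, smul_dotProduct, dotProduct_smul, hinner, Fin.sum_univ_two, one_mul]
      at hframe hode' ⊢
    linear_combination (Real.exp (U (γ (τ s)))) ^ 2 * (hode' + hframe)

lemma conformalMetric_neg :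
    conformalMetric (conformalMetric g U) (fun x => -U x) = g := by
  funext x
  rw [conformalMetric, conformalMetric, smul_smul, ← Real.exp_add]
  simp

lemma conformalFunction_neg (f : T2 → ℝ) :
    conformalFunction (conformalFunction f U) (fun x => -U x) = f := by
  funext x
  rw [conformalFunction, conformalFunction, ← mul_assoc, ← Real.exp_add]
  simp

lemma gradient_conformalMetric_neg (hg : IsRiemannianMetric g) (x : T2) :
    gradient (conformalMetric g U) (fun x => -U x) x = -(Real.exp (2 * U x) • gradient g U x) := by
  have h : (fun j => partialDeriv j (fun x => -U x) x) = -fun j => partialDeriv j U x := by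
    funext j
    exact deriv.fun_neg
  rw [gradient, conformalMetric_inv hg, h, Matrix.mulVec_neg, Matrix.smul_mulVec, gradient]

/-- The gradient of `-U` for the new metric is `-e^{2U} ∇U`, which cancels the added term. This
makes the change invertible and yields the converse. -/
lemma conformalField_neg (hg : IsRiemannianMetric g) (e : T2 → Plane) :
    conformalField (conformalMetric g U) (conformalField g e U) (fun x => -U x) = e := by
  funext x
  rw [conformalField, conformalField, gradient_conformalMetric_neg hg,
    smul_add (Real.exp (2 * U x)), add_neg_cancel_right, smul_smul, ← Real.exp_add]
  simp

end Conformal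

/-! ### Comparison of the exponential maps. -/

section Exponential

variable {o : Orientation ℝ Plane (Fin 2)} {g : T2 → Matrix (Fin 2) (Fin 2) ℝ} {f : T2 → ℝ}
  {e : T2 → Plane} {U : T2 → ℝ}

lemma ne_zero_of_metricNorm_eq_one {x : T2} {v : Plane} (hv : metricNorm g x v = 1) : v ≠ 0 := by
  rintro rfl
  simp [metricNorm, metricInner] at hv

/-- The exponential map follows any orbit through its base point. -/
lemma thermostatExp_smul (hg : IsRiemannianMetric g) (hf : IsSmooth f) (he : IsSmooth e)
    {γ : ℝ → T2} {v : ℝ → Plane} (h : IsThermostatOrbit o g f e γ v) {t : ℝ} (ht : 0 ≤ t) :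
    thermostatExp o g f e (γ 0) (t • v 0) = γ t := by
  rcases ht.eq_or_lt with rfl | ht
  · simp [thermostatExp]
  have hv1 : metricNorm g (γ 0) (v 0) = 1 := h.2.1 0
  have hex : ∃ q : (ℝ → T2) × (ℝ → Plane),
      IsThermostatOrbit o g f e q.1 q.2 ∧ q.1 0 = γ 0 ∧ q.2 0 = v 0 := ⟨(γ, v), h, rfl, rfl⟩
  rw [thermostatExp, if_neg (smul_ne_zero ht.ne' (ne_zero_of_metricNorm_eq_one hv1)),
    metricNorm_smul _ ht.le, hv1, mul_one, smul_smul, inv_mul_cancel₀ ht.ne', one_smul,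
    thermostatFlow, dif_pos hex]
  -- The flow follows some chosen orbit; uniqueness identifies it with `γ`.
  obtain ⟨h1, h2, h3⟩ := hex.choose_spec
  exact congrFun (h1.unique hg hf he h h2 h3) t

/-- If the exponential map at `x` is a local diffeomorphism, then every unit vector at `x` is the
initial velocity of an orbit. -/
lemma exists_orbit_of_isLocalDiffeoToTorus {x : T2}
    (hloc : IsLocalDiffeoToTorus (thermostatExp o g f e x)) {v : Plane}
    (hv : metricNorm g x v = 1) :
    ∃ γ w, IsThermostatOrbit o g f e γ w ∧ γ 0 = x ∧ w 0 = v := by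
  by_contra hno
  -- Without an orbit, `thermostatFlow` takes its default value, the initial point itself.
  have hconst (t : ℝ) (ht : 0 < t) : thermostatExp o g f e x (t • v) = x := by
    rw [thermostatExp, if_neg (smul_ne_zero ht.ne' (ne_zero_of_metricNorm_eq_one hv)),
      metricNorm_smul _ ht.le, hv, mul_one, smul_smul, inv_mul_cancel₀ ht.ne', one_smul,
      thermostatFlow, dif_neg]
    rintro ⟨⟨γ, w⟩, h⟩
    exact hno ⟨γ, w, h⟩
  obtain ⟨G, hG, hGd⟩ := hloc 0
  have h0 : proj (G 0) = x := by
    rw [← hG.self_of_nhds]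
    simp [thermostatExp]
  have hray : Filter.Tendsto (fun t : ℝ => t • v) (𝓝[>] 0) (𝓝 0) := by
    have h : Continuous fun t : ℝ => t • v := by fun_prop
    simpa using (h.tendsto 0).mono_left nhdsWithin_le_nhds
  have hclose : ∀ᶠ w in 𝓝 (0 : Plane), dist (G w) (G 0) < 1 :=
    hGd.contMDiffAt.continuousAt.eventually (Metric.ball_mem_nhds _ one_pos)
  have hinj := hGd.localInverse_eventuallyEq_left
  obtain ⟨t, ht1, ht2, ht3, ht⟩ := ((hray.eventually hG).and ((hray.eventually hclose).and
    ((hray.eventually hinj).and self_mem_nhdsWithin))).exists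
  -- Both are lifts of `x` at distance less than `1`, so they coincide, against local injectivity of
  -- `G`.
  have heq : G (t • v) = G 0 :=
    eq_of_proj_eq (by rw [← ht1, hconst t ht, h0]) ht2
  have ht4 := hinj.self_of_nhds
  simp only [Function.comp_apply, id] at ht3 ht4
  rw [heq, ht4] at ht3
  exact smul_ne_zero (ne_of_gt ht) (ne_zero_of_metricNorm_eq_one hv) ht3.symm

/-- The primitive of a function with a positive lower bound has a differentiable inverse. -/
lemma exists_inverse_primitive {ρ : ℝ → ℝ} (hρ : Continuous ρ) {c : ℝ} (hc : 0 < c)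
    (hcρ : ∀ t, c ≤ ρ t) :
    ∃ τ : ℝ → ℝ, (∀ t, τ (∫ r in (0 : ℝ)..t, ρ r) = t) ∧
      ∀ s, HasDerivAt τ (ρ (τ s))⁻¹ s := by
  set S : ℝ → ℝ := fun t => ∫ r in (0 : ℝ)..t, ρ r with hS
  have hd (t : ℝ) : HasDerivAt S (ρ t) t :=
    intervalIntegral.integral_hasDerivAt_right (hρ.intervalIntegrable _ _)
      hρ.aestronglyMeasurable.stronglyMeasurableAtFilter hρ.continuousAt
  have hd' (t : ℝ) : HasDerivAt (fun t => S t - c * t) (ρ t - c) t := by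
    have h := (hd t).sub ((hasDerivAt_id t).const_mul c)
    rw [mul_one] at h
    exact h
  -- This gives both the strict monotonicity of `S` and its linear growth at both ends, hence
  -- bijectivity.
  have hmono : Monotone fun t => S t - c * t :=
    monotone_of_deriv_nonneg (fun t => (hd' t).differentiableAt)
      fun t => by rw [(hd' t).deriv]; linarith [hcρ t]
  have hS0 : S 0 = 0 := by simp [hS]
  have hstrict : StrictMono S := fun a b hab => by
    have h1 : S a - c * a ≤ S b - c * b := hmono hab.le
    have h2 := mul_lt_mul_of_pos_left hab hc
    linarith
  have hcont : Continuous S := continuous_iff_continuousAt.2 fun t => (hd t).continuousAt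
  have htop : Filter.Tendsto S Filter.atTop Filter.atTop := by
    refine Filter.tendsto_atTop_mono' _ ?_ (Filter.tendsto_id.const_mul_atTop hc)
    filter_upwards [Filter.eventually_ge_atTop 0] with t ht
    have h1 : S 0 - c * 0 ≤ S t - c * t := hmono ht
    simp only [id]
    linarith
  have hbot : Filter.Tendsto S Filter.atBot Filter.atBot := by
    refine Filter.tendsto_atBot_mono' _ ?_ (Filter.tendsto_id.const_mul_atBot hc)
    filter_upwards [Filter.eventually_le_atBot 0] with t ht
    have h1 : S t - c * t ≤ S 0 - c * 0 := hmono ht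
    simp only [id]
    linarith
  let Φ := hstrict.orderIsoOfSurjective S (hcont.surjective htop hbot)
  have hΦ (t : ℝ) : Φ t = S t := rfl
  refine ⟨Φ.symm, fun t => ?_, fun s => ?_⟩
  · exact Φ.symm_apply_apply t
  · exact (hd (Φ.symm s)).of_local_left_inverse Φ.symm.continuous.continuousAt
      (hc.trans_le (hcρ _)).ne' (Filter.Eventually.of_forall fun y => Φ.apply_symm_apply y)

/-- Locally the exponential map is `proj ∘ G` with `G` of class `C^1`, and `U ∘ proj` is smooth. -/
lemma contDiff_exp_thermostatExp {x : T2} (hU : IsSmooth U)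
    (hloc : IsLocalDiffeoToTorus (thermostatExp o g f e x)) :
    ContDiff ℝ 1 fun w => Real.exp (-U (thermostatExp o g f e x w)) := by
  refine contDiff_iff_contDiffAt.2 fun w => ?_
  obtain ⟨G, hG, hGd⟩ := hloc w
  have h1 : ContDiffAt ℝ 1 (fun w => Real.exp (-U (proj (G w)))) w :=
    (((hU.contDiff.of_le (by simp)).contDiffAt.comp w hGd.contMDiffAt.contDiffAt).neg).exp
  refine h1.congr_of_eventuallyEq ?_
  filter_upwards [hG] with w' hw'
  rw [hw']

/-- The exponential maps of conformally related thermostats agree up to a radial map. -/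
lemma thermostatExp_conformal_radialMap (hg : IsRiemannianMetric g) (hf : IsSmooth f)
    (he : IsSmooth e) (hU : IsSmooth U) {x : T2}
    (hloc : IsLocalDiffeoToTorus (thermostatExp o g f e x)) (w : Plane) :
    thermostatExp o (conformalMetric g U) (conformalFunction f U) (conformalField g e U) x
      (radialMap (fun w => Real.exp (U x) * Real.exp (-U (thermostatExp o g f e x w))) w)
      = thermostatExp o g f e x w := by
  by_cases hw : w = 0
  · simp [hw, radialMap, thermostatExp]
  have hn := metricNorm_pos hg x hw
  set n := metricNorm g x w with hndef
  have hunit : metricNorm g x (n⁻¹ • w) = 1 := by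
    rw [metricNorm_smul _ (inv_pos.2 hn).le, ← hndef, inv_mul_cancel₀ hn.ne']
  obtain ⟨γ, v, horb, hγ0, hv0⟩ := exists_orbit_of_isLocalDiffeoToTorus hloc hunit
  have hw' : w = n • v 0 := by rw [hv0, smul_smul, mul_inv_cancel₀ hn.ne', one_smul]
  obtain ⟨b, hb, hbU⟩ := IsSmooth.exists_lower_bound
    (h := fun x => Real.exp (-U x)) hU.contDiff.neg.exp fun _ => Real.exp_pos _
  have hρ : Continuous fun t => Real.exp (-U (γ t)) := by
    obtain ⟨c, hc, hcv⟩ := horb.1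
    have hcc : Continuous c := continuous_iff_continuousAt.2 fun t => (hcv t).continuousAt
    have h1 := hU.contDiff.continuous.comp hcc
    simp only [Function.comp_def, hc] at h1
    exact Real.continuous_exp.comp h1.neg
  obtain ⟨τ, hτ, hτd⟩ := exists_inverse_primitive hρ hb fun t => hbU (γ t)
  have horb' := horb.conformal hg hU (τ := τ) fun s => by
    simpa only [Real.exp_neg, inv_inv] using hτd s
  have hτ0 : τ 0 = 0 := by simpa using hτ 0
  set s := ∫ r in (0 : ℝ)..n, Real.exp (-U (γ r)) with hs
  have hs0 : 0 ≤ s := intervalIntegral.integral_nonneg hn.le fun _ _ => (Real.exp_pos _).le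
  -- As `w = n • v 0`, the radial map sends `w` to `s` times the new initial velocity `e^{U(x)}
  -- v(0)`, where `s` is the new arc length at old time `n`.
  have hrad : radialMap (fun w => Real.exp (U x) * Real.exp (-U (thermostatExp o g f e x w))) w
      = s • (Real.exp (U (γ (τ 0))) • v (τ 0)) := by
    rw [radialMap, hτ0, hγ0]
    conv_lhs => rw [hw']
    rw [smul_smul, smul_smul, mul_comm, smul_radialMean, intervalIntegral.integral_const_mul,
      mul_comm s]
    congr 2
    refine intervalIntegral.integral_congr fun r hr => ?_
    rw [Set.uIcc_of_le hn.le] at hr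
    change Real.exp (-U (thermostatExp o g f e x (r • v 0))) = _
    rw [← hγ0, thermostatExp_smul hg hf he horb hr.1]
  have h1 := thermostatExp_smul (isRiemannianMetric_conformalMetric hg hU)
    (isSmooth_conformalFunction hf hU) (isSmooth_conformalField hg he hU) horb' hs0
  rw [← hrad, hτ0, hγ0] at h1
  rw [h1, hτ n, ← thermostatExp_smul hg hf he horb hn.le, hγ0, ← hw']

lemma IsLocalDiffeoToTorus.conformal (hg : IsRiemannianMetric g) (hf : IsSmooth f)
    (he : IsSmooth e) (hU : IsSmooth U) {x : T2}
    (hloc : IsLocalDiffeoToTorus (thermostatExp o g f e x)) :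
    IsLocalDiffeoToTorus (thermostatExp o (conformalMetric g U) (conformalFunction f U)
      (conformalField g e U) x) := by
  set F : Plane → ℝ := fun w => Real.exp (U x) * Real.exp (-U (thermostatExp o g f e x w)) with hF
  have hFd : ContDiff ℝ 1 F := contDiff_const.mul (contDiff_exp_thermostatExp hU hloc)
  obtain ⟨b, hb, hbU⟩ := IsSmooth.exists_lower_bound
    (h := fun x => Real.exp (-U x)) hU.contDiff.neg.exp fun _ => Real.exp_pos _
  have hFb (w : Plane) : Real.exp (U x) * b ≤ F w :=
    mul_le_mul_of_nonneg_left (hbU _) (Real.exp_pos _).le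
  have hFpos (w : Plane) : 0 < F w := mul_pos (Real.exp_pos _) (Real.exp_pos _)
  intro w₁
  obtain ⟨w, rfl⟩ := surjective_radialMap hFd.continuous (mul_pos (Real.exp_pos _) hb) hFb w₁
  obtain ⟨G, hG, hGd⟩ := hloc w
  have hΦ := isLocalDiffeomorphAt_of_injective_fderiv (contDiff_radialMap hFd)
    (injective_fderiv_radialMap hFd hFpos) w
  -- The local inverse must return to the chosen `w`, since `G` describes the old exponential map
  -- only near `w`.
  have hinv : hΦ.localInverse (radialMap F w) = w :=
    hΦ.localInverse_left_inv hΦ.localInverse_mem_target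
  refine ⟨G ∘ hΦ.localInverse, ?_, ?_⟩
  · have hcont : Filter.Tendsto hΦ.localInverse (𝓝 (radialMap F w)) (𝓝 w) := by
      have h := hΦ.localInverse_contMDiffAt.continuousAt.tendsto
      rwa [hinv] at h
    filter_upwards [hcont.eventually hG, hΦ.localInverse_eventuallyEq_right] with w' h1 h2
    simp only [Function.comp_apply, id] at h2 ⊢
    rw [← h1, ← thermostatExp_conformal_radialMap hg hf he hU hloc, h2]
  · exact hΦ.localInverse_isLocalDiffeomorphAt.comp (K := 𝓘(ℝ, Plane)) (P := Plane)
      (by rwa [hinv])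

end Exponential

end Thermostat

end
-- The equivalence.
theorem mainTheorem3
    (o : Orientation ℝ Thermostat.Plane (Fin 2))
    (g : Thermostat.T2 → Matrix (Fin 2) (Fin 2) ℝ) (hg : Thermostat.IsRiemannianMetric g)
    (f : Thermostat.T2 → ℝ) (hf : Thermostat.IsSmooth f)
    (e : Thermostat.T2 → Thermostat.Plane) (he : Thermostat.IsSmooth e)
    (U : Thermostat.T2 → ℝ) (hU : Thermostat.IsSmooth U) :
    Thermostat.NoConjugatePoints o g f e ↔
      Thermostat.NoConjugatePoints o
        (fun x => Real.exp (-2 * U x) • g x)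
        (fun x => Real.exp (U x) * f x)
        (fun x => Real.exp (2 * U x) • (e x + Thermostat.gradient g U x)) := by
  refine ⟨fun h x => (h x).conformal hg hf he hU, fun h x => ?_⟩
  have hU' : Thermostat.IsSmooth (fun x => -U x) := hU.contDiff.neg
  -- The converse applies the forward direction to the new thermostat and `-U`, which recovers the
  -- original data.
  have h1 := Thermostat.IsLocalDiffeoToTorus.conformal
    (Thermostat.isRiemannianMetric_conformalMetric hg hU)
    (Thermostat.isSmooth_conformalFunction hf hU)
    (Thermostat.isSmooth_conformalField hg he hU) hU' (h x)
  rwa [Thermostat.conformalMetric_neg, Thermostat.conformalFunction_neg,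
    Thermostat.conformalField_neg hg] at h1
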